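/- Let $(W,S)$ be the Coxeter system of affine type $\widetilde{A}_2$, that is, $S=\{s_0,s_1,s_2\}$ and $W=\langle s_0,s_1,s_2 \mid s_i^2=1,\ (s_is_j)^3=1 \text{ for } i\neq j\rangle$, with length function $\ell$, identity element $\mathrm{id}$ and Bruhat order $\le$ (the reflexive transitive closure of the relation "$w=ut$ for some conjugate $t$ of an element of $S$, and $\ell(u)<\ell(w)$"). For $u\in W$ let $[\mathrm{id},u]=\{z\in W : \mathrm{id}\le z\le u\}$, partially ordered by $\le$. Let $G$ be the subgroup of the symmetric group of the set $W$ generated by the automorphism $\delta$ of $W$ with $s_0\mapsto s_1\mapsto s_2\mapsto s_0$, the automorphism $\sigma$ of $W$ that fixes $s_0$ and exchanges $s_1$ and $s_2$, and the inversion $\iota\colon x\mapsto x^{-1}$. Then $G$ has order $12$, and for all $u,v\in W$, the intervals $[\mathrm{id},u]$ and $[\mathrm{id},v]$ are isomorphic as posets if and only if $v$ belongs to the $G$-orbit of $u$. -/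

import Mathlib

namespace CoxeterSystem

/-- One step of the Bruhat order of a Coxeter system: `w = u * t` for a reflection `t`
(a conjugate of a simple reflection), and `ℓ u < ℓ w`. -/
def BruhatStep {B W : Type*} [Group W] {M : CoxeterMatrix B} (cs : CoxeterSystem M W)
    (u w : W) : Prop :=
  ∃ t : W, cs.IsReflection t ∧ w = u * t ∧ cs.length u < cs.length w

/-- The Bruhat order of a Coxeter system: the reflexive transitive closure of `BruhatStep`. -/
def BruhatLE {B W : Type*} [Group W] {M : CoxeterMatrix B} (cs : CoxeterSystem M W) :
    W → W → Prop :=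
  Relation.ReflTransGen cs.BruhatStep

theorem BruhatLE.eq_or_length_lt {B W : Type*} [Group W] {M : CoxeterMatrix B}
    {cs : CoxeterSystem M W} {u w : W} (h : cs.BruhatLE u w) :
    u = w ∨ cs.length u < cs.length w := by
  induction h with
  | refl => exact Or.inl rfl
  | tail _ hs ih =>
    obtain ⟨t, _, _, hlt⟩ := hs
    rcases ih with rfl | ih
    · exact Or.inr hlt
    · exact Or.inr (ih.trans hlt)

theorem BruhatLE.antisymm {B W : Type*} [Group W] {M : CoxeterMatrix B}
    {cs : CoxeterSystem M W} {u w : W} (h : cs.BruhatLE u w) (h' : cs.BruhatLE w u) :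
    u = w := by
  rcases h.eq_or_length_lt with e | hlt
  · exact e
  · rcases h'.eq_or_length_lt with e | hlt'
    · exact e.symm
    · omega

end CoxeterSystem

/-- The Coxeter matrix of affine type `A₂`: three generators, any two distinct ones of which
have a product of order `3` (the Dynkin diagram is a triangle). -/
def affineA2Matrix : CoxeterMatrix (Fin 3) where
  M := Matrix.of fun i j : Fin 3 ↦ if i = j then 1 else 3
  isSymm := by unfold Matrix.IsSymm; aesop
  diagonal := by simp
  off_diagonal := by aesop

/-- The affine Weyl group of type `Ã₂`, given by its Coxeter presentation
`⟨s₀, s₁, s₂ | sᵢ² = 1, (sᵢ sⱼ)³ = 1 for i ≠ j⟩`. -/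
def AffineA2 : Type := affineA2Matrix.Group

namespace AffineA2

instance instGroup : Group AffineA2 := inferInstanceAs (Group affineA2Matrix.Group)

/-- The standard Coxeter system on `AffineA2`. -/
def cs : CoxeterSystem affineA2Matrix AffineA2 := affineA2Matrix.toCoxeterSystem

/-- `AffineA2` is partially ordered by the Bruhat order. -/
instance instPartialOrder : PartialOrder AffineA2 where
  le := cs.BruhatLE
  le_refl _ := Relation.ReflTransGen.refl
  le_trans _ _ _ h h' := Relation.ReflTransGen.trans h h'
  le_antisymm _ _ h h' := h.antisymm h'

theorem isLiftable_perm (e : Equiv.Perm (Fin 3)) :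
    affineA2Matrix.IsLiftable fun i ↦ cs.simple (e i) := by
  intro i j
  have h : affineA2Matrix i j = affineA2Matrix (e i) (e j) := by
    change (if i = j then 1 else 3) = if e i = e j then 1 else 3
    simp
  rw [h]
  exact cs.simple_mul_simple_pow (e i) (e j)

/-- The endomorphism of `AffineA2` with `sᵢ ↦ s_{e i}`. -/
def diagramHom (e : Equiv.Perm (Fin 3)) : AffineA2 →* AffineA2 :=
  cs.lift ⟨fun i ↦ cs.simple (e i), isLiftable_perm e⟩

theorem diagramHom_simple (e : Equiv.Perm (Fin 3)) (i : Fin 3) :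
    diagramHom e (cs.simple i) = cs.simple (e i) :=
  cs.lift_apply_simple (isLiftable_perm e) i

theorem diagramHom_comp_symm (e : Equiv.Perm (Fin 3)) :
    (diagramHom e).comp (diagramHom e.symm) = MonoidHom.id AffineA2 :=
  cs.ext_simple fun i ↦ by simp [diagramHom_simple]

/-- The automorphism of `AffineA2` induced by a symmetry `e` of the Dynkin diagram, a triangle,
of which every permutation of the nodes is a symmetry: `sᵢ ↦ s_{e i}`. -/
def diagramAut (e : Equiv.Perm (Fin 3)) : AffineA2 ≃* AffineA2 :=
  MonoidHom.toMulEquiv (diagramHom e) (diagramHom e.symm)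
    (diagramHom_comp_symm e.symm) (diagramHom_comp_symm e)

/-- The automorphism induced by the rotation `s₀ ↦ s₁ ↦ s₂ ↦ s₀` of the diagram. -/
def δ : AffineA2 ≃* AffineA2 := diagramAut (Equiv.addRight 1)

/-- The automorphism induced by the reflection of the diagram that fixes `s₀` and exchanges
`s₁` and `s₂`. -/
def σ : AffineA2 ≃* AffineA2 := diagramAut (Equiv.swap 1 2)

/-- The inversion `x ↦ x⁻¹`, as a permutation of `AffineA2`. -/
def ι : Equiv.Perm AffineA2 := Equiv.inv AffineA2

/-- The group of generic automorphisms: the group of permutations of `AffineA2` generated by the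
diagram automorphisms `δ`, `σ` and the inversion `ι`. -/
def G : Subgroup (Equiv.Perm AffineA2) :=
  Subgroup.closure {δ.toEquiv, σ.toEquiv, ι}

end AffineA2

namespace AffineA2

/-! Diagram symmetries and inversion preserve length and the Bruhat order, so orbits give isomorphic
intervals. For the converse, an isomorphism `f` of lower intervals preserves length, and an element
of length at least 3 is determined by the elements strictly below it (`eq_of_forall_lt_iff`). So `f`
is the identity once it fixes everything of length at most 2 (`IsLowerIso.eq_self`).

If `u` is `Full`, a diagram symmetry makes `f` fix the simple reflections. Each `sᵢ sⱼ` is then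
fixed or reversed, and elements `sᵢ sₖ sⱼ` of length 3 force one choice for all pairs; inversion
undoes the reversal. The remaining elements are, up to diagram symmetries, ten short words
(`full_or_exists_smallWord`), separated up to reversal by their length and the number of elements of
length 2 below them.

The Bruhat order is handled by strong exchange, the lifting property and the subword property. -/

/-! ### Signed reflections and strong exchange. -/

theorem simple_braid {i j : Fin 3} (h : i ≠ j) :
    cs.simple i * cs.simple j * cs.simple i = cs.simple j * cs.simple i * cs.simple j := by
  have h1 := cs.simple_mul_simple_pow i j
  have h2 : affineA2Matrix i j = 3 := if_neg h
  rw [h2, pow_three] at h1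
  have h3 := mul_eq_one_iff_eq_inv.mp h1
  have : cs.simple i * cs.simple j * (cs.simple i * cs.simple j * (cs.simple i * cs.simple j)) *
    (cs.simple j * cs.simple i * cs.simple j) = cs.simple j * cs.simple i * cs.simple j := by
    rw [h1, one_mul]
  simpa [mul_assoc] using this

open Classical in
/-- The action of a simple reflection on pairs of a group element `t` and a sign: `t` is
conjugated, and the sign changes if `t` is that simple reflection. -/
noncomputable def signedConj (i : Fin 3) : Function.End (AffineA2 × ZMod 2) := fun p ↦
  (cs.simple i * p.1 * cs.simple i, p.2 + if p.1 = cs.simple i then 1 else 0)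

theorem conj_simple_eq_iff (i : Fin 3) (t u : AffineA2) :
    cs.simple i * t * cs.simple i = u ↔ t = cs.simple i * u * cs.simple i := by
  constructor <;> rintro rfl <;> simp [mul_assoc]

theorem isLiftable_signedConj : affineA2Matrix.IsLiftable signedConj := by
  classical
  intro i j
  by_cases h : i = j
  · subst h
    have h2 : affineA2Matrix i i = 1 := if_pos rfl
    rw [h2, pow_one]
    funext p
    change (_, _) = p
    ext
    · simp [signedConj, mul_assoc]
    · have : cs.simple i * p.1 * cs.simple i = cs.simple i ↔ p.1 = cs.simple i := by
        rw [conj_simple_eq_iff]; simp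
      simp only [signedConj, this]
      split_ifs <;> simp [add_assoc, CharTwo.add_self_eq_zero]
  · have h2 : affineA2Matrix i j = 3 := if_neg h
    rw [h2, pow_three]
    have hb := simple_braid h
    funext p
    change signedConj i (signedConj j (signedConj i (signedConj j
      (signedConj i (signedConj j p))))) = p
    obtain ⟨t, ε⟩ := p
    set a := cs.simple i with ha
    set b := cs.simple j with hb0
    have aa : a * a = 1 := cs.simple_mul_simple_self i
    have bb : b * b = 1 := cs.simple_mul_simple_self j
    have bab : b * a * b = a * b * a := hb.symm
    -- The six sign tests, pulled back to `t`, hit `b`, `bab`, `a`, `b`, `bab`, `a`: each reflection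
    -- twice, so the signs cancel.
    have k2 : b * t * b = a ↔ t = b * a * b := conj_simple_eq_iff j t a
    have k3 : a * (b * t * b) * a = b ↔ t = a := by
      rw [conj_simple_eq_iff i, conj_simple_eq_iff j, ← ha, ← hb0, ← bab]
      simp [mul_assoc, hb0]
    have k4 : b * (a * (b * t * b) * a) * b = a ↔ t = b := by
      rw [conj_simple_eq_iff j, conj_simple_eq_iff i, conj_simple_eq_iff j, ← ha, ← hb0, bab]
      rw [show b * (a * (a * b * a) * a) * b = b * (a * a) * b * (a * a) * b by group, aa]
      simp [bb]
    have k5 : a * (b * (a * (b * t * b) * a) * b) * a = b ↔ t = b * a * b := by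
      rw [conj_simple_eq_iff i, conj_simple_eq_iff j, conj_simple_eq_iff i, conj_simple_eq_iff j,
        ← ha, ← hb0, ← bab]
      rw [show b * (a * (b * (b * a * b) * b) * a) * b = b * (a * (b * b) * a * (b * b) * a) * b
        by group, bb]
      simp [aa]
    have k6 : b * (a * (b * (a * (b * t * b) * a) * b) * a) * b = a ↔ t = a := by
      rw [conj_simple_eq_iff j, conj_simple_eq_iff i, conj_simple_eq_iff j, conj_simple_eq_iff i,
        conj_simple_eq_iff j, ← ha, ← hb0, bab]
      rw [show b * (a * (b * (a * (a * b * a) * a) * b) * a) * b =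
        b * (a * (b * (a * a) * b * (a * a) * b) * a) * b by group, aa]
      simp only [mul_one, bb, one_mul]
      rw [bab.symm]
      rw [show b * (b * a * b) * b = b * b * a * (b * b) by group, bb]
      simp
    ext
    · change a * (b * (a * (b * (a * (b * t * b) * a) * b) * a) * b) * a = t
      rw [show a * (b * (a * (b * (a * (b * t * b) * a) * b) * a) * b) * a =
        (a * b * a) * (b * a * b) * t * ((b * a * b) * (a * b * a)) by group, ← bab]
      rw [show b * a * b * (b * a * b) = b * (a * (b * b) * a) * b by group, bb]
      simp [aa, bb]
    · simp only [signedConj, ← ha, ← hb0, k2, k3, k4, k5, k6]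
      generalize (if t = b then (1 : ZMod 2) else 0) = x
      generalize (if t = a then (1 : ZMod 2) else 0) = y
      generalize (if t = b * a * b then (1 : ZMod 2) else 0) = z
      linear_combination CharTwo.add_self_eq_zero x + CharTwo.add_self_eq_zero y +
        CharTwo.add_self_eq_zero z

/-- The action of the group on signed elements that extends `signedConj`. -/
noncomputable def signedConjHom : AffineA2 →* Function.End (AffineA2 × ZMod 2) :=
  cs.lift ⟨signedConj, isLiftable_signedConj⟩

theorem signedConjHom_simple (i : Fin 3) : signedConjHom (cs.simple i) = signedConj i :=
  cs.lift_apply_simple isLiftable_signedConj i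

open Classical in
-- Consequently the parity of the number of occurrences of `t` in the inversion sequence depends
-- only on the element, not on the word.
theorem signedConjHom_wordProd (ω : List (Fin 3)) (t : AffineA2) (ε : ZMod 2) :
    signedConjHom (cs.wordProd ω) (t, ε) =
      (cs.wordProd ω * t * (cs.wordProd ω)⁻¹, ε + ((cs.rightInvSeq ω).count t : ZMod 2)) := by
  induction ω with
  | nil => simp; rfl
  | cons i ω ih =>
    rw [cs.wordProd_cons, map_mul]
    change signedConjHom (cs.simple i) (signedConjHom (cs.wordProd ω) (t, ε)) = _
    rw [ih, signedConjHom_simple]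
    have key : cs.wordProd ω * t * (cs.wordProd ω)⁻¹ = cs.simple i ↔
        (cs.wordProd ω)⁻¹ * cs.simple i * cs.wordProd ω = t := by
      constructor
      · intro h; rw [← h]; group
      · rintro rfl; group
    ext
    · simp [signedConj, mul_assoc]
    · simp only [signedConj, key, CoxeterSystem.rightInvSeq, List.count_cons, beq_iff_eq]
      push_cast
      ring

theorem signedConjHom_add (w t : AffineA2) (ε η : ZMod 2) :
    signedConjHom w (t, ε + η) =
      ((signedConjHom w (t, ε)).1, (signedConjHom w (t, ε)).2 + η) := by
  classical
  obtain ⟨ω, rfl⟩ := cs.wordProd_surjective w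
  simp only [signedConjHom_wordProd]
  ext
  · rfl
  · simp only; ring

theorem signedConjHom_reflection {t : AffineA2} (ht : cs.IsReflection t) (ε : ZMod 2) :
    signedConjHom t (t, ε) = (t, ε + 1) := by
  classical
  obtain ⟨w, i, rfl⟩ := ht
  obtain ⟨ε', h⟩ : ∃ ε', signedConjHom w⁻¹ (w * cs.simple i * w⁻¹, ε) = (cs.simple i, ε') := by
    obtain ⟨ω, hω⟩ := cs.wordProd_surjective w⁻¹
    refine ⟨_, Prod.ext ?_ rfl⟩
    rw [← hω, signedConjHom_wordProd, hω]
    simp [mul_assoc]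
  have h' : signedConjHom w (cs.simple i, ε') = (w * cs.simple i * w⁻¹, ε) := by
    rw [← h]
    change (signedConjHom w * signedConjHom w⁻¹) _ = _
    rw [← map_mul]; simp; rfl
  rw [map_mul, map_mul]
  change signedConjHom w (signedConjHom (cs.simple i) (signedConjHom w⁻¹ _)) = _
  rw [h, signedConjHom_simple]
  have : signedConj i (cs.simple i, ε') = (cs.simple i, ε' + 1) := by simp [signedConj]
  rw [this, signedConjHom_add, h']

/-- The strong exchange property. -/
theorem mem_rightInvSeq_of_isRightInversion {ω : List (Fin 3)} {t : AffineA2}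
    (h : cs.IsRightInversion (cs.wordProd ω) t) : t ∈ cs.rightInvSeq ω := by
  classical
  by_contra hn
  obtain ⟨ht, hl⟩ := h
  obtain ⟨ω', hr, hω'⟩ := cs.exists_isReduced (cs.wordProd ω * t)
  -- As `t` flips its own sign, its parities for `w` and `w t` differ. If it is even for `w`, then
  -- `t` occurs in a reduced word of `w t` and is an inversion of `w t`, contradicting `ℓ (w t) < ℓ
  -- w`.
  have h1 : signedConjHom (cs.wordProd ω * t) (t, 0) =
      signedConjHom (cs.wordProd ω) (t, 0 + 1) := by
    rw [map_mul, ← signedConjHom_reflection ht]; rfl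
  rw [hω', signedConjHom_wordProd, signedConjHom_wordProd, List.count_eq_zero_of_not_mem hn] at h1
  have h2 : t ∈ cs.rightInvSeq ω' := by
    by_contra hn'
    rw [List.count_eq_zero_of_not_mem hn'] at h1
    simpa using congrArg Prod.snd h1
  have h3 := (cs.isRightInversion_of_mem_rightInvSeq hr h2).2
  rw [← hω', mul_assoc, ht.mul_self, mul_one] at h3
  omega

/-! ### Lifting and subword properties of the Bruhat order. -/

theorem BruhatStep.lt {u w : AffineA2} (h : cs.BruhatStep u w) : u < w := by
  refine lt_of_le_of_ne (Relation.ReflTransGen.single h) ?_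
  rintro rfl
  obtain ⟨_, _, _, h⟩ := h
  exact lt_irrefl _ h

theorem length_lt_of_lt {u w : AffineA2} (h : u < w) : cs.length u < cs.length w :=
  (CoxeterSystem.BruhatLE.eq_or_length_lt (cs := cs) h.le).resolve_left h.ne

theorem lt_mul_of_isReflection {u t : AffineA2} (ht : cs.IsReflection t)
    (h : cs.length u < cs.length (u * t)) : u < u * t :=
  BruhatStep.lt ⟨t, ht, rfl, h⟩

theorem lt_mul_simple {u : AffineA2} {i : Fin 3} (h : ¬ cs.IsRightDescent u i) :
    u < u * cs.simple i :=
  lt_mul_of_isReflection (cs.isReflection_simple i)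
    (by rw [cs.not_isRightDescent_iff] at h; omega)

theorem mul_simple_lt {u : AffineA2} {i : Fin 3} (h : cs.IsRightDescent u i) :
    u * cs.simple i < u := by
  have := lt_mul_simple (cs.isRightDescent_iff_not_isRightDescent_mul.mp h)
  simpa using this

theorem le_inv {u w : AffineA2} (h : u ≤ w) : u⁻¹ ≤ w⁻¹ := by
  induction h with
  | refl => exact le_rfl
  | @tail u' _ _ hs ih =>
    refine ih.trans ?_
    obtain ⟨t, ht, rfl, hl⟩ := hs
    refine (BruhatStep.lt ⟨u' * t * u'⁻¹, ht.conj _, ?_, ?_⟩).le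
    · simp [mul_assoc, ht.inv]
    · rwa [cs.length_inv, cs.length_inv]

theorem inv_le_inv_iff' {u w : AffineA2} : u⁻¹ ≤ w⁻¹ ↔ u ≤ w :=
  ⟨fun h ↦ by simpa using le_inv h, le_inv⟩

theorem inv_lt_inv_iff' {u w : AffineA2} : u⁻¹ < w⁻¹ ↔ u < w := by
  simp only [lt_iff_le_not_ge, inv_le_inv_iff']

/-- Strong exchange in a word of `w` ending in `i`: either the last letter is deleted, or an earlier
one is and the final `i` can be cancelled on both sides. -/
theorem BruhatStep.mul_simple {u w : AffineA2} {i : Fin 3} (h : cs.BruhatStep u w)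
    (hw : cs.IsRightDescent w i) :
    u = w * cs.simple i ∨ u * cs.simple i < w * cs.simple i := by
  obtain ⟨t, ht, rfl, hl⟩ := h
  obtain ⟨ω, hr, hω⟩ := cs.exists_isReduced (u * t * cs.simple i)
  have hw' : u * t = cs.wordProd (ω.concat i) := by
    rw [cs.wordProd_concat, ← hω]; simp
  have hmem : t ∈ cs.rightInvSeq (ω.concat i) := by
    apply mem_rightInvSeq_of_isRightInversion
    rw [← hw']
    exact ⟨ht, by simpa [mul_assoc, ht.mul_self] using hl⟩
  rw [cs.rightInvSeq_concat, List.concat_eq_append, List.mem_append, List.mem_map,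
    List.mem_singleton] at hmem
  rcases hmem with ⟨t', ht', rfl⟩ | rfl
  · right
    have h1 := cs.isRightInversion_of_mem_rightInvSeq hr ht'
    have e : u * cs.simple i = cs.wordProd ω * t' := by
      rw [← hω]; simp [MulAut.conj_apply, mul_assoc, h1.1.mul_self]
    rw [hω, e]
    refine BruhatStep.lt ⟨t', h1.1, ?_, h1.2⟩
    simp [mul_assoc, h1.1.mul_self]
  · left
    simp

theorem BruhatStep.mul_simple' {u w : AffineA2} (i : Fin 3) (h : cs.BruhatStep u w) :
    u * cs.simple i = w ∨ u * cs.simple i < w * cs.simple i := by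
  by_cases hl : cs.length (u * cs.simple i) < cs.length (w * cs.simple i)
  · right
    obtain ⟨t, ht, rfl, _⟩ := h
    refine BruhatStep.lt ⟨cs.simple i * t * (cs.simple i)⁻¹, ht.conj _, ?_, hl⟩
    simp [mul_assoc]
  · have hlt : cs.length u < cs.length w := length_lt_of_lt (BruhatStep.lt h)
    have h1 := cs.length_mul_simple u i
    have h2 := cs.length_mul_simple w i
    rcases BruhatStep.mul_simple (i := i) h (by unfold CoxeterSystem.IsRightDescent; omega)
      with h' | h'
    · left; rw [h']; simp
    · exact absurd (length_lt_of_lt h') hl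

theorem mul_simple_le_or {u w : AffineA2} (i : Fin 3) (h : u ≤ w) :
    u * cs.simple i ≤ w ∨ u * cs.simple i ≤ w * cs.simple i := by
  induction h using Relation.ReflTransGen.head_induction_on with
  | refl => exact Or.inr le_rfl
  | head hs hle ih =>
    rcases BruhatStep.mul_simple' i hs with h' | h'
    · left; rw [h']; exact hle
    · exact ih.imp h'.le.trans h'.le.trans

/-- The lifting property: if `u ≤ w` and `w` has the right descent `sᵢ`, then `u` or `u sᵢ` is
below `w sᵢ`. -/
theorem le_mul_simple_or {u w : AffineA2} {i : Fin 3} (h : u ≤ w) (hw : cs.IsRightDescent w i) :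
    u ≤ w * cs.simple i ∨ cs.IsRightDescent u i ∧ u * cs.simple i ≤ w * cs.simple i := by
  induction h using Relation.ReflTransGen.head_induction_on with
  | refl => exact Or.inr ⟨hw, le_rfl⟩
  | head hs hle ih =>
    have hlt := BruhatStep.lt hs
    rcases ih with h' | ⟨hd, h'⟩
    · exact Or.inl (hlt.le.trans h')
    · rename_i x y
      by_cases hx : cs.IsRightDescent x i
      · right
        refine ⟨hx, ?_⟩
        rcases BruhatStep.mul_simple' i hs with e | e
        · exact absurd e ((mul_simple_lt hx).trans hlt).ne
        · exact e.le.trans h'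
      · left
        rcases BruhatStep.mul_simple hs hd with e | e
        · rwa [e]
        · exact ((lt_mul_simple hx).trans e).le.trans h'

theorem le_mul_simple_of_not_isRightDescent {u w : AffineA2} {i : Fin 3} (h : u ≤ w)
    (hw : cs.IsRightDescent w i) (hu : ¬ cs.IsRightDescent u i) : u ≤ w * cs.simple i :=
  (le_mul_simple_or h hw).resolve_right fun h' ↦ hu h'.1

theorem mul_simple_le_mul_simple {u w : AffineA2} {i : Fin 3} (h : u ≤ w)
    (hw : ¬ cs.IsRightDescent w i) : u * cs.simple i ≤ w * cs.simple i :=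
  (mul_simple_le_or i h).elim (fun h' ↦ h'.trans (lt_mul_simple hw).le) id

theorem one_le (w : AffineA2) : 1 ≤ w := by
  generalize hn : cs.length w = n
  induction n using Nat.strong_induction_on generalizing w with
  | _ n ih =>
    by_cases hw : w = 1
    · rw [hw]
    · obtain ⟨i, hi⟩ := cs.exists_rightDescent_of_ne_one hw
      exact (ih _ (hn ▸ hi) _ rfl).trans (mul_simple_lt hi).le

theorem not_isRightDescent_wordProd {ω : List (Fin 3)} {i : Fin 3}
    (h : cs.IsReduced (ω ++ [i])) : ¬ cs.IsRightDescent (cs.wordProd ω) i := by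
  have h1 := h.eq
  have h2 := cs.length_wordProd_le ω
  rw [cs.wordProd_append, cs.wordProd_singleton, List.length_append, List.length_singleton] at h1
  unfold CoxeterSystem.IsRightDescent
  omega

theorem IsReduced.of_append {ω ω' : List (Fin 3)} (h : cs.IsReduced (ω ++ ω')) :
    cs.IsReduced ω := by
  simpa using h.take ω.length

theorem wordProd_le_of_sublist {ω η : List (Fin 3)} (h : cs.IsReduced ω) (hs : η.Sublist ω) :
    cs.wordProd η ≤ cs.wordProd ω := by
  induction ω using List.reverseRecOn generalizing η with
  | nil => simp [List.sublist_nil.mp hs]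
  | append_singleton ω i ih =>
    have hd := not_isRightDescent_wordProd h
    have hr : cs.IsReduced ω := IsReduced.of_append h
    rw [cs.wordProd_append, cs.wordProd_singleton]
    obtain ⟨l₁, l₂, rfl, h₁, h₂⟩ := List.sublist_append_iff.mp hs
    rcases List.sublist_singleton.mp h₂ with rfl | rfl
    · simpa using (ih hr h₁).trans (lt_mul_simple hd).le
    · rw [cs.wordProd_append, cs.wordProd_singleton]
      exact mul_simple_le_mul_simple (ih hr h₁) hd

/-- The subword property. -/
theorem exists_sublist_of_le {ω : List (Fin 3)} {x : AffineA2} (h : cs.IsReduced ω)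
    (hx : x ≤ cs.wordProd ω) : ∃ η, η.Sublist ω ∧ cs.IsReduced η ∧ x = cs.wordProd η := by
  induction ω using List.reverseRecOn generalizing x with
  | nil =>
    refine ⟨[], List.Sublist.refl _, by simp [CoxeterSystem.IsReduced], ?_⟩
    exact le_antisymm hx (by simpa using one_le x)
  | append_singleton ω i ih =>
    have hd := not_isRightDescent_wordProd h
    have hr : cs.IsReduced ω := IsReduced.of_append h
    have hd' : cs.IsRightDescent (cs.wordProd (ω ++ [i])) i := by
      rw [cs.isRightDescent_iff_not_isRightDescent_mul]
      simpa [cs.wordProd_append] using hd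
    -- Lifting decides whether the subword uses the last letter.
    rcases le_mul_simple_or hx hd' with h' | ⟨hxd, h'⟩
    · obtain ⟨η, h1, h2, h3⟩ := ih (x := x) hr (by simpa [cs.wordProd_append] using h')
      exact ⟨η, h1.trans (List.sublist_append_left _ _), h2, h3⟩
    · obtain ⟨η, h1, h2, h3⟩ := ih (x := x * cs.simple i) hr
        (by simpa [cs.wordProd_append] using h')
      refine ⟨η ++ [i], h1.append (List.Sublist.refl _), ?_, ?_⟩
      · rw [CoxeterSystem.IsReduced, cs.wordProd_append, cs.wordProd_singleton, ← h3,
          List.length_append, List.length_singleton, ← h2.eq, ← h3]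
        simpa using (cs.isRightDescent_iff.mp hxd).symm
      · rw [cs.wordProd_append, cs.wordProd_singleton, ← h3]; simp

/-! ### Products of two simple reflections. -/

theorem isLiftable_swap : affineA2Matrix.IsLiftable
    fun i : Fin 3 ↦ Equiv.swap i.castSucc (3 : Fin 4) := by
  intro i j
  change _ ^ (if i = j then 1 else 3) = _
  revert i j
  decide

/-- The quotient of `AffineA2` by which it acts on four points, `sᵢ` being the transposition that
exchanges `i` with the last point. -/
def starHom : AffineA2 →* Equiv.Perm (Fin 4) :=
  cs.lift ⟨_, isLiftable_swap⟩

theorem starHom_simple (i : Fin 3) :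
    starHom (cs.simple i) = Equiv.swap i.castSucc (3 : Fin 4) :=
  cs.lift_apply_simple isLiftable_swap i

theorem simple_injective : Function.Injective cs.simple := by
  intro i j h
  have := congrArg starHom h
  simp only [starHom_simple] at this
  clear h
  revert i j
  decide

theorem simple_mul_simple_inj {i j k l : Fin 3} (hij : i ≠ j)
    (h : cs.simple i * cs.simple j = cs.simple k * cs.simple l) : i = k ∧ j = l := by
  have := congrArg starHom h
  simp only [map_mul, starHom_simple] at this
  clear h
  revert i j k l
  decide

theorem length_simple_mul_simple {i j : Fin 3} (h : i ≠ j) :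
    cs.length (cs.simple i * cs.simple j) = 2 := by
  rcases cs.length_mul_simple (cs.simple i) j with e | e
  · rw [e, cs.length_simple]
  · rw [cs.length_simple] at e
    have : cs.length (cs.simple i * cs.simple j) = 0 := by omega
    rw [cs.length_eq_zero_iff, mul_eq_one_iff_eq_inv, cs.inv_simple] at this
    exact absurd (simple_injective this) h

/-! ### Recovering an element from the elements below it. -/

theorem eq_of_le_of_length_le {x y : AffineA2} (h : x ≤ y) (hl : cs.length y ≤ cs.length x) :
    x = y := by
  by_contra hne
  have := length_lt_of_lt (lt_of_le_of_ne h hne)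
  omega

/-- Lifting puts `w sᵢ`, which lacks the descent `i`, below `w' sᵢ`; the lengths agree, so the two
coincide. -/
theorem eq_of_common_isRightDescent {w w' : AffineA2} {i : Fin 3} (h : ∀ x, x < w → x < w')
    (hl : cs.length w = cs.length w') (hw : cs.IsRightDescent w i)
    (hw' : cs.IsRightDescent w' i) : w = w' := by
  have h1 := le_mul_simple_of_not_isRightDescent (h _ (mul_simple_lt hw)).le hw'
    (cs.isRightDescent_iff_not_isRightDescent_mul.mp hw)
  rw [cs.isRightDescent_iff] at hw hw'
  exact mul_right_cancel (eq_of_le_of_length_le h1 (by omega))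

theorem eq_of_common_isLeftDescent {w w' : AffineA2} {i : Fin 3} (h : ∀ x, x < w → x < w')
    (hl : cs.length w = cs.length w') (hw : cs.IsLeftDescent w i)
    (hw' : cs.IsLeftDescent w' i) : w = w' := by
  refine inv_injective (eq_of_common_isRightDescent (w := w⁻¹) (w' := w'⁻¹) (i := i) ?_ ?_
    (cs.isRightDescent_inv_iff.mpr hw) (cs.isRightDescent_inv_iff.mpr hw'))
  · intro x hx
    rw [← inv_lt_inv_iff', inv_inv] at hx ⊢
    exact h _ hx
  · simpa using hl

theorem isRightDescent_mul_simple {x : AffineA2} {i j : Fin 3} (hij : i ≠ j)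
    (hi : cs.IsRightDescent x i) (hj : cs.IsRightDescent x j) :
    cs.IsRightDescent (x * cs.simple i) j := by
  by_contra hn
  have li := cs.isRightDescent_iff.mp hi
  have lj := cs.isRightDescent_iff.mp hj
  exact hij (simple_injective (mul_left_cancel (eq_of_le_of_length_le
    (le_mul_simple_of_not_isRightDescent (mul_simple_lt hi).le hj hn) (by omega))))

theorem isLeftDescent_mul_of_length {y p : AffineA2} {i : Fin 3} (hy : cs.IsLeftDescent y i)
    (h : cs.length (y * p) = cs.length y + cs.length p) : cs.IsLeftDescent (y * p) i := by
  unfold CoxeterSystem.IsLeftDescent at hy ⊢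
  have := cs.length_mul_le (cs.simple i * y) p
  rw [mul_assoc] at this
  omega

theorem eq_of_common_left_factor {w w' y p p' : AffineA2} (h : ∀ x, x < w → x < w')
    (hl : cs.length w = cs.length w') (hw : w = y * p) (hw' : w' = y * p') (hy : y ≠ 1)
    (hp : cs.length w = cs.length y + cs.length p)
    (hp' : cs.length w' = cs.length y + cs.length p') : w = w' := by
  obtain ⟨i, hi⟩ := cs.exists_leftDescent_of_ne_one hy
  subst hw hw'
  exact eq_of_common_isLeftDescent h hl (isLeftDescent_mul_of_length hi hp)
    (isLeftDescent_mul_of_length hi hp')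

theorem isRightDescent_of_lt {w w' : AffineA2} {i j : Fin 3} (h : w * cs.simple i < w')
    (hl : cs.length w = cs.length w') (hi : cs.IsRightDescent w i) (hj : cs.IsRightDescent w' j)
    (hne : w * cs.simple i ≠ w' * cs.simple j) : cs.IsRightDescent (w * cs.simple i) j := by
  by_contra hn
  refine hne (eq_of_le_of_length_le (le_mul_simple_of_not_isRightDescent h.le hj hn) ?_)
  rw [cs.isRightDescent_iff] at hi hj
  omega

/-- If `w` ends in `sⱼ sᵢ`, but does not have the right descent `sⱼ`, then the remaining prefix
does not have the right descent `sᵢ`. -/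
theorem not_isRightDescent_prefix {w : AffineA2} {i j : Fin 3} (hij : i ≠ j)
    (hi : cs.IsRightDescent w i) (hj : ¬ cs.IsRightDescent w j)
    (hij' : cs.IsRightDescent (w * cs.simple i) j) :
    ¬ cs.IsRightDescent (w * cs.simple i * cs.simple j) i := by
  intro hd
  apply hj
  have l1 := cs.isRightDescent_iff.mp hi
  have l2 := cs.isRightDescent_iff.mp hij'
  have l3 := cs.isRightDescent_iff.mp hd
  -- By the braid relation `w sⱼ` is a product of an element of length `ℓ w - 3` and two simple
  -- reflections, hence shorter than `w`.
  have e : w * cs.simple j =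
      w * cs.simple i * cs.simple j * cs.simple i * (cs.simple j * cs.simple i) := by
    have hb := simple_braid hij
    rw [show w * cs.simple i * cs.simple j * cs.simple i * (cs.simple j * cs.simple i) =
      w * (cs.simple i * cs.simple j * cs.simple i) * (cs.simple j * cs.simple i) by group, hb]
    simp [mul_assoc]
  unfold CoxeterSystem.IsRightDescent
  rw [e]
  have h1 := cs.length_mul_le (w * cs.simple i * cs.simple j * cs.simple i)
    (cs.simple j * cs.simple i)
  have h2 := cs.length_mul_le (cs.simple j) (cs.simple i)
  simp only [cs.length_simple] at h2
  omega

/-- An element of length at least `3` is determined by the elements strictly below it. -/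
theorem eq_of_forall_lt_iff {w w' : AffineA2} (h : ∀ x, x < w ↔ x < w')
    (hw : 3 ≤ cs.length w) : w = w' := by
  have hw1 : w ≠ 1 := by rintro rfl; simp at hw
  obtain ⟨i, hi⟩ := cs.exists_rightDescent_of_ne_one hw1
  have li := cs.isRightDescent_iff.mp hi
  have h1 := length_lt_of_lt ((h _).mp (mul_simple_lt hi))
  have hw1' : w' ≠ 1 := by rintro rfl; simp at h1
  obtain ⟨j, hj⟩ := cs.exists_rightDescent_of_ne_one hw1'
  have lj := cs.isRightDescent_iff.mp hj
  have h2 := length_lt_of_lt ((h _).mpr (mul_simple_lt hj))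
  have hl : cs.length w = cs.length w' := by omega
  by_cases hi' : cs.IsRightDescent w' i
  · exact eq_of_common_isRightDescent (fun x ↦ (h x).mp) hl hi hi'
  by_cases hj' : cs.IsRightDescent w j
  · exact eq_of_common_isRightDescent (fun x ↦ (h x).mp) hl hj' hj
  have hij : i ≠ j := by rintro rfl; exact hi' hj
  by_cases hne : w * cs.simple i = w' * cs.simple j
  · refine eq_of_common_left_factor (y := w * cs.simple i) (p := cs.simple i)
      (p' := cs.simple j) (fun x ↦ (h x).mp) hl (by simp) (by simp [hne]) ?_ ?_ ?_
    · intro e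
      have := cs.length_one
      rw [← e] at this
      omega
    · rw [cs.length_simple]; omega
    · rw [cs.length_simple]; omega
  · have hd := isRightDescent_of_lt ((h _).mp (mul_simple_lt hi)) hl hi hj hne
    have hd' := isRightDescent_of_lt ((h _).mpr (mul_simple_lt hj)) hl.symm hj hi (Ne.symm hne)
    have hn := not_isRightDescent_prefix hij hi hj' hd
    have l2 := cs.isRightDescent_iff.mp hd
    have l2' := cs.isRightDescent_iff.mp hd'
    set y := w * cs.simple i * cs.simple j with hy
    have l3 := cs.not_isRightDescent_iff.mp hn
    have ew : w = y * (cs.simple j * cs.simple i) := by simp [hy, mul_assoc]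
    -- Since `w = y sⱼ sᵢ`, deleting `sⱼ` gives an element below `w`, hence below `w'`. It will turn
    -- out to be `w' sⱼ`, so that `y` is a left factor of both.
    have hyw : y * cs.simple i < w := by
      refine BruhatStep.lt ⟨cs.simple i * cs.simple j * (cs.simple i)⁻¹,
        (cs.isReflection_simple j).conj _, ?_, by omega⟩
      rw [ew]; simp [mul_assoc]
    have hyw' := (h _).mp hyw
    have hnd : ¬ cs.IsRightDescent (y * cs.simple i) j := by
      intro hc
      have hc' : cs.IsRightDescent (y * cs.simple i) i := by
        rw [cs.isRightDescent_iff_not_isRightDescent_mul]; simpa using hn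
      have h4 : cs.IsRightDescent y j := by
        simpa using isRightDescent_mul_simple hij hc' hc
      exact cs.isRightDescent_iff_not_isRightDescent_mul.mp hd h4
    have e2 : y * cs.simple i = w' * cs.simple j :=
      eq_of_le_of_length_le (le_mul_simple_of_not_isRightDescent hyw'.le hj hnd) (by omega)
    have ew' : w' = y * (cs.simple i * cs.simple j) := by
      rw [← mul_assoc, e2]; simp
    refine eq_of_common_left_factor (fun x ↦ (h x).mp) hl ew ew' ?_ ?_ ?_
    -- Length at least 3 is essential here: with `y = 1`, `sᵢ sⱼ` and `sⱼ sᵢ` have the same elements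
    -- strictly below them.
    · intro e
      have := cs.length_one
      rw [← e] at this
      omega
    · rw [length_simple_mul_simple hij.symm]; omega
    · rw [length_simple_mul_simple hij]; omega

/-! ### Generic automorphisms and the group `G`. -/

theorem diagramHom_wordProd (e : Equiv.Perm (Fin 3)) (ω : List (Fin 3)) :
    diagramHom e (cs.wordProd ω) = cs.wordProd (ω.map e) := by
  induction ω with
  | nil => simp
  | cons i ω ih => simp [cs.wordProd_cons, ih, diagramHom_simple]

theorem diagramHom_diagramHom (e e' : Equiv.Perm (Fin 3)) (w : AffineA2) :
    diagramHom e (diagramHom e' w) = diagramHom (e * e') w := by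
  obtain ⟨ω, rfl⟩ := cs.wordProd_surjective w
  simp [diagramHom_wordProd]

theorem diagramHom_one (w : AffineA2) : diagramHom 1 w = w := by
  obtain ⟨ω, rfl⟩ := cs.wordProd_surjective w
  simp [diagramHom_wordProd]

theorem length_diagramHom (e : Equiv.Perm (Fin 3)) (w : AffineA2) :
    cs.length (diagramHom e w) = cs.length w := by
  have key : ∀ (e : Equiv.Perm (Fin 3)) (w : AffineA2),
      cs.length (diagramHom e w) ≤ cs.length w := by
    intro e w
    obtain ⟨ω, hr, rfl⟩ := cs.exists_isReduced w
    rw [diagramHom_wordProd, hr.eq]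
    simpa using cs.length_wordProd_le (ω.map e)
  refine le_antisymm (key e w) ?_
  simpa [diagramHom_diagramHom, diagramHom_one] using key e⁻¹ (diagramHom e w)

theorem diagramHom_le (e : Equiv.Perm (Fin 3)) {u w : AffineA2} (h : u ≤ w) :
    diagramHom e u ≤ diagramHom e w := by
  induction h with
  | refl => exact le_rfl
  | tail _ hs ih =>
    refine ih.trans (BruhatStep.lt ?_).le
    obtain ⟨t, ⟨x, i, rfl⟩, rfl, hl⟩ := hs
    refine ⟨_, ⟨diagramHom e x, e i, rfl⟩, ?_, by simpa only [length_diagramHom] using hl⟩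
    simp [diagramHom_simple]

/-- The automorphism of `AffineA2` as a poset induced by a diagram symmetry `e`. -/
def diagramOrderIso (e : Equiv.Perm (Fin 3)) : AffineA2 ≃o AffineA2 where
  toFun := diagramHom e
  invFun := diagramHom e⁻¹
  left_inv w := by simp [diagramHom_diagramHom, diagramHom_one]
  right_inv w := by simp [diagramHom_diagramHom, diagramHom_one]
  map_rel_iff' {u w} := by
    refine ⟨fun h ↦ ?_, diagramHom_le e⟩
    simpa [diagramHom_diagramHom, diagramHom_one] using diagramHom_le e⁻¹ h

/-- Inversion, as an automorphism of `AffineA2` as a poset. -/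
def invOrderIso : AffineA2 ≃o AffineA2 where
  toEquiv := Equiv.inv AffineA2
  map_rel_iff' := inv_le_inv_iff'

/-- A diagram symmetry followed by inversion if `b` is true. -/
def genericAut (p : Equiv.Perm (Fin 3) × Bool) : AffineA2 ≃o AffineA2 :=
  (diagramOrderIso p.1).trans (if p.2 then invOrderIso else OrderIso.refl _)

theorem genericAut_apply_false (e : Equiv.Perm (Fin 3)) (w : AffineA2) :
    genericAut (e, false) w = diagramHom e w := rfl

theorem genericAut_apply_true (e : Equiv.Perm (Fin 3)) (w : AffineA2) :
    genericAut (e, true) w = (diagramHom e w)⁻¹ := rfl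

theorem genericAut_mul (p q : Equiv.Perm (Fin 3) × Bool) (w : AffineA2) :
    genericAut p (genericAut q w) = genericAut (p.1 * q.1, xor p.2 q.2) w := by
  obtain ⟨e, b⟩ := p
  obtain ⟨e', b'⟩ := q
  cases b <;> cases b' <;>
    simp [genericAut_apply_false, genericAut_apply_true, diagramHom_diagramHom]

theorem genericAut_injective :
    Function.Injective fun p ↦ (genericAut p).toEquiv := by
  intro p q h
  obtain ⟨e, b⟩ := p
  obtain ⟨e', b'⟩ := q
  have h' : ∀ w, genericAut (e, b) w = genericAut (e', b') w := fun w ↦ Equiv.congr_fun h w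
  have he : e = e' := by
    ext1 i
    have := h' (cs.simple i)
    cases b <;> cases b' <;>
      simp only [genericAut_apply_false, genericAut_apply_true, diagramHom_simple,
        cs.inv_simple] at this <;> exact simple_injective this
  subst he
  -- Simple reflections are involutions and only see `e`; a product of two of them detects the
  -- inversion.
  have h2 := h' (cs.simple 0 * cs.simple 1)
  have hne : e 0 ≠ e 1 := by simp
  cases b <;> cases b' <;>
    simp only [genericAut_apply_false, genericAut_apply_true, diagramHom_simple, map_mul,
      mul_inv_rev, cs.inv_simple] at h2
  · rfl
  · exact absurd (simple_mul_simple_inj hne h2).1 hne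
  · exact absurd (simple_mul_simple_inj hne.symm h2).2 hne
  · rfl

theorem perm_fin_three_eq (e : Equiv.Perm (Fin 3)) :
    ∃ i : Fin 3, ∃ j : Fin 2, e = Equiv.addRight 1 ^ (i : ℕ) * Equiv.swap 1 2 ^ (j : ℕ) := by
  revert e
  decide

theorem diagramOrderIso_mem_G (e : Equiv.Perm (Fin 3)) : (diagramOrderIso e).toEquiv ∈ G := by
  have hmul : ∀ e e', (diagramOrderIso (e * e')).toEquiv =
      (diagramOrderIso e).toEquiv * (diagramOrderIso e').toEquiv := by
    intro e e'
    ext w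
    exact (diagramHom_diagramHom e e' w).symm
  have hpow : ∀ e, (diagramOrderIso e).toEquiv ∈ G → ∀ n : ℕ,
      (diagramOrderIso (e ^ n)).toEquiv ∈ G := by
    intro e he n
    induction n with
    | zero =>
      convert G.one_mem
      ext w
      exact diagramHom_one w
    | succ n ih => rw [pow_succ, hmul]; exact G.mul_mem ih he
  obtain ⟨i, j, rfl⟩ := perm_fin_three_eq e
  rw [hmul]
  refine G.mul_mem (hpow _ ?_ _) (hpow _ ?_ _)
  · have : (diagramOrderIso (Equiv.addRight 1)).toEquiv = δ.toEquiv := by ext w; rfl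
    rw [this]
    exact Subgroup.subset_closure (by simp)
  · have : (diagramOrderIso (Equiv.swap 1 2)).toEquiv = σ.toEquiv := by ext w; rfl
    rw [this]
    exact Subgroup.subset_closure (by simp)

/-- Inversion commutes with diagram symmetries, so the generic automorphisms already form a group, a
copy of `S₃ × ℤ/2`. -/
theorem mem_G_iff (g : Equiv.Perm AffineA2) : g ∈ G ↔ ∃ p, (genericAut p).toEquiv = g := by
  constructor
  · intro h
    induction h using Subgroup.closure_induction with
    | mem g hg =>
      rcases hg with rfl | rfl | rfl
      · exact ⟨(Equiv.addRight 1, false), by ext w; rfl⟩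
      · exact ⟨(Equiv.swap 1 2, false), by ext w; rfl⟩
      · refine ⟨(1, true), ?_⟩
        ext w
        change (diagramHom 1 w)⁻¹ = w⁻¹
        rw [diagramHom_one]
    | one => exact ⟨(1, false), by ext w; exact diagramHom_one w⟩
    | mul g g' _ _ ih ih' =>
      obtain ⟨p, rfl⟩ := ih
      obtain ⟨q, rfl⟩ := ih'
      exact ⟨_, by ext w; exact (genericAut_mul p q w).symm⟩
    | inv g _ ih =>
      obtain ⟨p, rfl⟩ := ih
      refine ⟨(p.1⁻¹, p.2), ?_⟩
      rw [eq_inv_iff_mul_eq_one]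
      ext w
      change genericAut _ (genericAut p w) = w
      rw [genericAut_mul]
      simp [genericAut_apply_false, diagramHom_one]
  · rintro ⟨⟨e, b⟩, rfl⟩
    cases b
    · exact diagramOrderIso_mem_G e
    · exact G.mul_mem (Subgroup.subset_closure (by simp) : ι ∈ G) (diagramOrderIso_mem_G e)

theorem card_G : Nat.card G = 12 := by
  have : (G : Set (Equiv.Perm AffineA2)) = Set.range fun p ↦ (genericAut p).toEquiv := by
    ext g
    simp [mem_G_iff]
  change Nat.card (G : Set (Equiv.Perm AffineA2)) = 12
  rw [this, Nat.card_range_of_injective genericAut_injective, Nat.card_eq_fintype_card]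
  rfl

theorem mem_orbit_iff {u v : AffineA2} : v ∈ MulAction.orbit G u ↔ ∃ p, v = genericAut p u := by
  constructor
  · rintro ⟨⟨g, hg⟩, rfl⟩
    obtain ⟨p, rfl⟩ := (mem_G_iff g).mp hg
    exact ⟨p, rfl⟩
  · rintro ⟨p, rfl⟩
    exact ⟨⟨_, (mem_G_iff _).mpr ⟨p, rfl⟩⟩, rfl⟩

theorem nonempty_orderIso_of_mem_orbit {u v : AffineA2} (h : v ∈ MulAction.orbit G u) :
    Nonempty (Set.Icc (1 : AffineA2) u ≃o Set.Icc (1 : AffineA2) v) := by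
  obtain ⟨p, rfl⟩ := mem_orbit_iff.mp h
  refine ⟨{ toEquiv := (genericAut p).toEquiv.subtypeEquiv fun x ↦ ?_, map_rel_iff' := ?_ }⟩
  · simp [one_le]
  · intro x y
    exact (genericAut p).le_iff_le

/-! ### Isomorphisms of lower intervals. -/

/-- `f` restricts to an isomorphism from the elements below `u` to the elements below `v`. -/
structure IsLowerIso (u v : AffineA2) (f : AffineA2 → AffineA2) : Prop where
  le_iff : ∀ x ≤ u, ∀ y ≤ u, f x ≤ f y ↔ x ≤ y
  map_le : ∀ x ≤ u, f x ≤ v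
  exists_eq : ∀ y ≤ v, ∃ x ≤ u, f x = y

namespace IsLowerIso

variable {u v : AffineA2} {f : AffineA2 → AffineA2}

theorem of_orderIso (φ : Set.Icc (1 : AffineA2) u ≃o Set.Icc (1 : AffineA2) v) :
    ∃ f, IsLowerIso u v f := by
  classical
  -- The value `1` off the interval is never inspected.
  refine ⟨fun x ↦ if h : x ≤ u then (φ ⟨x, one_le x, h⟩ : AffineA2) else 1, ⟨?_, ?_, ?_⟩⟩
  · intro x hx y hy
    simp only [dif_pos hx, dif_pos hy, Subtype.coe_le_coe, OrderIso.le_iff_le]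
    exact Iff.rfl
  · intro x hx
    simp only [dif_pos hx]
    exact (φ _).2.2
  · intro y hy
    refine ⟨φ.symm ⟨y, one_le y, hy⟩, (φ.symm _).2.2, ?_⟩
    rw [dif_pos (φ.symm _).2.2]
    exact congrArg Subtype.val (φ.apply_symm_apply _)

theorem trans (h : IsLowerIso u v f) (g : AffineA2 ≃o AffineA2) :
    IsLowerIso u (g v) (g ∘ f) where
  le_iff x hx y hy := by simpa using h.le_iff x hx y hy
  map_le x hx := by simpa using h.map_le x hx
  exists_eq y hy := by
    obtain ⟨x, hx, e⟩ := h.exists_eq (g.symm y) (by rwa [OrderIso.symm_apply_le])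
    exact ⟨x, hx, by simp [e]⟩

variable (h : IsLowerIso u v f)
include h

theorem injOn {x y : AffineA2} (hx : x ≤ u) (hy : y ≤ u) (e : f x = f y) : x = y :=
  le_antisymm ((h.le_iff x hx y hy).mp e.le) ((h.le_iff y hy x hx).mp e.ge)

theorem lt_iff {x y : AffineA2} (hx : x ≤ u) (hy : y ≤ u) : f x < f y ↔ x < y := by
  simp only [lt_iff_le_not_ge, h.le_iff x hx y hy, h.le_iff y hy x hx]

theorem map_top : f u = v := by
  obtain ⟨x, hx, rfl⟩ := h.exists_eq v le_rfl
  exact le_antisymm (h.map_le u le_rfl) ((h.le_iff x hx u le_rfl).mpr hx)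

/-- Length is the height in the poset: every `x ≠ 1` has an element one shorter below it. Such
descents are pulled back along `f` for one inequality and pushed forward for the other. -/
theorem length_eq {x : AffineA2} (hx : x ≤ u) : cs.length (f x) = cs.length x := by
  apply le_antisymm
  · have key : ∀ n y, cs.length y = n → ∀ x ≤ u, f x = y → cs.length y ≤ cs.length x := by
      intro n
      induction n with
      | zero => intro y hy x _ _; omega
      | succ n ih =>
        rintro y hy x hx rfl
        obtain ⟨i, hi⟩ := cs.exists_rightDescent_of_ne_one (w := f x)
          (by rintro e; simp [e] at hy)
        obtain ⟨x', hx', e⟩ := h.exists_eq _ ((mul_simple_lt hi).le.trans (h.map_le x hx))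
        have h1 := cs.isRightDescent_iff.mp hi
        have h2 := ih _ (by omega) x' hx' e
        have h3 : x' < x := by
          rw [← h.lt_iff hx' hx, e]; exact mul_simple_lt hi
        have := length_lt_of_lt h3
        omega
    exact key _ _ rfl x hx rfl
  · generalize hn : cs.length x = n
    induction n generalizing x with
    | zero => exact Nat.zero_le _
    | succ n ih =>
      obtain ⟨i, hi⟩ := cs.exists_rightDescent_of_ne_one (w := x)
        (by rintro e; simp [e] at hn)
      have h1 := cs.isRightDescent_iff.mp hi
      have h2 := ih ((mul_simple_lt hi).le.trans hx) (by omega)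
      have := length_lt_of_lt ((h.lt_iff ((mul_simple_lt hi).le.trans hx) hx).mpr
        (mul_simple_lt hi))
      omega

theorem map_one : f 1 = 1 := by
  rw [← cs.length_eq_zero_iff, h.length_eq (one_le u), cs.length_one]

theorem eq_self (h2 : ∀ x ≤ u, cs.length x ≤ 2 → f x = x) {x : AffineA2} (hx : x ≤ u) :
    f x = x := by
  generalize hn : cs.length x = n
  induction n using Nat.strong_induction_on generalizing x with
  | _ n ih =>
    by_cases hn2 : n ≤ 2
    · exact h2 x hx (by omega)
    · refine eq_of_forall_lt_iff (fun y ↦ ⟨fun hy ↦ ?_, fun hy ↦ ?_⟩)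
        (by rw [h.length_eq hx]; omega)
      · obtain ⟨x', hx', rfl⟩ := h.exists_eq y (hy.le.trans (h.map_le x hx))
        have hlt := (h.lt_iff hx' hx).mp hy
        rwa [ih _ (hn ▸ length_lt_of_lt hlt) hx' rfl]
      · have hyu := hy.le.trans hx
        have := (h.lt_iff hyu hx).mpr hy
        rwa [ih _ (hn ▸ length_lt_of_lt hy) hyu rfl] at this

end IsLowerIso

/-! ### Rigidity below full elements. -/

theorem isReduced_simple_mul_simple {i j : Fin 3} (h : i ≠ j) : cs.IsReduced [i, j] := by
  simpa [CoxeterSystem.IsReduced, cs.wordProd_cons] using length_simple_mul_simple h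

theorem exists_eq_simple_mul_simple {x : AffineA2} (h : cs.length x = 2) :
    ∃ i j, i ≠ j ∧ x = cs.simple i * cs.simple j := by
  obtain ⟨ω, hr, rfl⟩ := cs.exists_isReduced x
  rw [hr.eq, List.length_eq_two] at h
  obtain ⟨i, j, rfl⟩ := h
  refine ⟨i, j, ?_, by simp [cs.wordProd_cons]⟩
  rintro rfl
  simp [CoxeterSystem.IsReduced, cs.wordProd_cons] at hr

theorem simple_le_simple_mul_simple_iff {i j k : Fin 3} (h : i ≠ j) :
    cs.simple k ≤ cs.simple i * cs.simple j ↔ k = i ∨ k = j := by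
  have e : cs.simple i * cs.simple j = cs.wordProd [i, j] := by simp [cs.wordProd_cons]
  rw [e]
  constructor
  · intro hk
    obtain ⟨η, hs, hr, hη⟩ := exists_sublist_of_le (isReduced_simple_mul_simple h) hk
    have hl : η.length = 1 := by rw [← hr.eq, ← hη, cs.length_simple]
    obtain ⟨l, rfl⟩ := List.length_eq_one_iff.mp hl
    rw [cs.wordProd_singleton] at hη
    rw [simple_injective hη]
    simpa using hs
  · intro hk
    simpa using wordProd_le_of_sublist (η := [k]) (isReduced_simple_mul_simple h)
      (by simpa using hk)

theorem simple_mul_simple_le_wordProd_iff {i j : Fin 3} {ω : List (Fin 3)} (h : i ≠ j)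
    (hω : cs.IsReduced ω) :
    cs.simple i * cs.simple j ≤ cs.wordProd ω ↔ [i, j].Sublist ω := by
  have e : cs.simple i * cs.simple j = cs.wordProd [i, j] := by simp [cs.wordProd_cons]
  constructor
  · intro hk
    obtain ⟨η, hs, hr, hη⟩ := exists_sublist_of_le hω hk
    have hl : η.length = 2 := by rw [← hr.eq, ← hη, length_simple_mul_simple h]
    obtain ⟨k, l, rfl⟩ := List.length_eq_two.mp hl
    obtain ⟨rfl, rfl⟩ := simple_mul_simple_inj (k := k) (l := l) h
      (by simpa [cs.wordProd_cons] using hη)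
    exact hs
  · intro hk
    rw [e]
    exact wordProd_le_of_sublist hω hk

/-- `u` is above all elements of length `2`, and above a product of the three generators with any
given one in the middle. -/
def Full (u : AffineA2) : Prop :=
  (∀ i j, i ≠ j → cs.simple i * cs.simple j ≤ u) ∧
    ∀ k, ∃ i j, i ≠ k ∧ k ≠ j ∧ i ≠ j ∧ cs.simple i * cs.simple k * cs.simple j ≤ u

theorem Full.mono {u v : AffineA2} (hu : Full u) (h : u ≤ v) : Full v := by
  refine ⟨fun i j hij ↦ (hu.1 i j hij).trans h, fun k ↦ ?_⟩
  obtain ⟨i, j, h1, h2, h3, h4⟩ := hu.2 k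
  exact ⟨i, j, h1, h2, h3, h4.trans h⟩

theorem isReduced_triple {i k j : Fin 3} (hik : i ≠ k) (hkj : k ≠ j) (hij : i ≠ j) :
    cs.IsReduced [i, k, j] := by
  have hp : cs.wordProd [i, k, j] = cs.simple i * cs.simple k * cs.simple j := by
    simp [cs.wordProd_cons, mul_assoc]
  rw [CoxeterSystem.IsReduced, hp]
  rcases cs.length_mul_simple (cs.simple i * cs.simple k) j with e | e
  · rw [e, length_simple_mul_simple hik]; rfl
  · exfalso
    have hd : cs.IsRightDescent (cs.simple i * cs.simple k) j := cs.isRightDescent_iff.mpr e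
    have hj : cs.simple j ≤ cs.simple i * cs.simple k := by
      have := mul_simple_le_mul_simple (i := j) (one_le (cs.simple i * cs.simple k * cs.simple j))
        (cs.isRightDescent_iff_not_isRightDescent_mul.mp hd)
      simpa using this
    rcases (simple_le_simple_mul_simple_iff hik).mp hj with h | h
    · exact hij h.symm
    · exact hkj h.symm

/-- Three distinct letters in three places occur once each, so their order is linear and not cyclic.
-/
theorem not_cyclic_sublists (a b c i j k : Fin 3) (hik : i ≠ k) (hkj : k ≠ j) (hij : i ≠ j) :
    ¬ ([i, k].Sublist [a, b, c] ∧ [k, j].Sublist [a, b, c] ∧ [j, i].Sublist [a, b, c]) := by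
  revert a b c i j k
  decide

theorem not_cyclic_of_length_eq_three {x : AffineA2} {i j k : Fin 3} (hx : cs.length x = 3)
    (hik : i ≠ k) (hkj : k ≠ j) (hij : i ≠ j) (h₁ : cs.simple i * cs.simple k ≤ x)
    (h₂ : cs.simple k * cs.simple j ≤ x) (h₃ : cs.simple j * cs.simple i ≤ x) : False := by
  obtain ⟨ω, hr, rfl⟩ := cs.exists_isReduced x
  rw [simple_mul_simple_le_wordProd_iff ‹_› hr] at h₁ h₂
  rw [simple_mul_simple_le_wordProd_iff hij.symm hr] at h₃
  rw [hr.eq, List.length_eq_three] at hx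
  obtain ⟨a, b, c, rfl⟩ := hx
  exact not_cyclic_sublists a b c i j k hik hkj hij ⟨h₁, h₂, h₃⟩

/-- `R` colours the edges of a triangle with two colours. In a nonconstant colouring one edge
differs from the other two, and the vertex opposite to it violates `hmid`. -/
theorem forall_or_forall_not_of_middle {R : Fin 3 → Fin 3 → Prop}
    (hsymm : ∀ i j, i ≠ j → (R i j ↔ R j i))
    (hmid : ∀ k, ∃ i j, i ≠ k ∧ k ≠ j ∧ i ≠ j ∧
      ¬ (R i k ∧ R k j ∧ ¬ R i j) ∧ ¬ (¬ R i k ∧ ¬ R k j ∧ R i j)) :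
    (∀ i j, i ≠ j → R i j) ∨ ∀ i j, i ≠ j → ¬ R i j := by
  have key : ∀ i j k, i ≠ k → k ≠ j → i ≠ j →
      ¬ (R k i ∧ R k j ∧ ¬ R i j) ∧ ¬ (¬ R k i ∧ ¬ R k j ∧ R i j) := by
    intro i j k hik hkj hij
    obtain ⟨i', j', h1, h2, h3, h4⟩ := hmid k
    have s1 := hsymm i k hik
    have s2 := hsymm k j hkj
    have s3 := hsymm i j hij
    have : (i' = i ∧ j' = j) ∨ (i' = j ∧ j' = i) := by omega
    rcases this with ⟨rfl, rfl⟩ | ⟨rfl, rfl⟩ <;> tauto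
  have m0 := key 1 2 0 (by decide) (by decide) (by decide)
  have m1 := key 0 2 1 (by decide) (by decide) (by decide)
  have m2 := key 0 1 2 (by decide) (by decide) (by decide)
  have s01 := hsymm 0 1 (by decide)
  have s02 := hsymm 0 2 (by decide)
  have s12 := hsymm 1 2 (by decide)
  have pairs : ∀ i j : Fin 3, i ≠ j → (i = 0 ∧ j = 1) ∨ (i = 1 ∧ j = 0) ∨ (i = 0 ∧ j = 2) ∨
      (i = 2 ∧ j = 0) ∨ (i = 1 ∧ j = 2) ∨ (i = 2 ∧ j = 1) := by decide
  by_cases h01 : R 0 1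
  · left
    have h02 : R 0 2 := by grind
    have h12 : R 1 2 := by grind
    intro i j hij
    rcases pairs i j hij with ⟨rfl, rfl⟩ | ⟨rfl, rfl⟩ | ⟨rfl, rfl⟩ | ⟨rfl, rfl⟩ | ⟨rfl, rfl⟩ |
      ⟨rfl, rfl⟩
    exacts [h01, s01.mp h01, h02, s02.mp h02, h12, s12.mp h12]
  · right
    have h02 : ¬ R 0 2 := by grind
    have h12 : ¬ R 1 2 := by grind
    intro i j hij
    rcases pairs i j hij with ⟨rfl, rfl⟩ | ⟨rfl, rfl⟩ | ⟨rfl, rfl⟩ | ⟨rfl, rfl⟩ | ⟨rfl, rfl⟩ |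
      ⟨rfl, rfl⟩
    exacts [h01, s01.not.mp h01, h02, s02.not.mp h02, h12, s12.not.mp h12]

namespace IsLowerIso

variable {u v : AffineA2} {f : AffineA2 → AffineA2}

theorem exists_perm (h : IsLowerIso u v f) (hu : ∀ i, cs.simple i ≤ u) :
    ∃ e : Equiv.Perm (Fin 3), ∀ i, f (cs.simple i) = cs.simple (e i) := by
  have : ∀ i, ∃ j, f (cs.simple i) = cs.simple j := fun i ↦ by
    rw [← cs.length_eq_one_iff, h.length_eq (hu i), cs.length_simple]
  choose e he using this
  have hinj : Function.Injective e := fun i j hij ↦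
    simple_injective (h.injOn (hu i) (hu j) (by rw [he, he, hij]))
  exact ⟨Equiv.ofBijective e (Finite.injective_iff_bijective.mp hinj), he⟩

theorem map_simple_mul_simple (h : IsLowerIso u v f) (hu : ∀ i, cs.simple i ≤ u)
    (hf : ∀ i, f (cs.simple i) = cs.simple i) {i j : Fin 3} (hij : i ≠ j)
    (hiju : cs.simple i * cs.simple j ≤ u) :
    f (cs.simple i * cs.simple j) = cs.simple i * cs.simple j ∨
      f (cs.simple i * cs.simple j) = cs.simple j * cs.simple i := by
  obtain ⟨k, l, hkl, e⟩ := exists_eq_simple_mul_simple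
    ((h.length_eq hiju).trans (length_simple_mul_simple hij))
  have key : ∀ m, m = k ∨ m = l ↔ m = i ∨ m = j := by
    intro m
    rw [← simple_le_simple_mul_simple_iff hkl, ← simple_le_simple_mul_simple_iff hij, ← e,
      ← h.le_iff _ (hu m) _ hiju, hf]
  rw [e]
  have : (k = i ∧ l = j) ∨ (k = j ∧ l = i) := by
    have k1 := (key k).mp (Or.inl rfl)
    have k2 := (key l).mp (Or.inr rfl)
    omega
  rcases this with ⟨rfl, rfl⟩ | ⟨rfl, rfl⟩
  · exact Or.inl rfl
  · exact Or.inr rfl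

theorem eq_of_agree (h : IsLowerIso u v f)
    (hf : ∀ i, f (cs.simple i) = cs.simple i)
    (hf2 : ∀ i j, i ≠ j → f (cs.simple i * cs.simple j) = cs.simple i * cs.simple j) :
    v = u := by
  rw [← h.map_top]
  refine h.eq_self (fun x hx hl ↦ ?_) le_rfl
  have : cs.length x = 0 ∨ cs.length x = 1 ∨ cs.length x = 2 := by omega
  rcases this with h0 | h0 | h0
  · rw [cs.length_eq_zero_iff.mp h0, h.map_one]
  · obtain ⟨i, rfl⟩ := cs.length_eq_one_iff.mp h0
    exact hf i
  · obtain ⟨i, j, hij, rfl⟩ := exists_eq_simple_mul_simple h0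
    exact hf2 i j hij

theorem exists_genericAut_of_full (h : IsLowerIso u v f) (hu : Full u) :
    ∃ p, genericAut p v = u := by
  have hs : ∀ i, cs.simple i ≤ u := fun i ↦ by
    have hi : i ≠ i + 1 := by revert i; decide
    exact ((simple_le_simple_mul_simple_iff hi).mpr (Or.inl rfl)).trans (hu.1 i _ hi)
  obtain ⟨e, he⟩ := h.exists_perm hs
  have h1 := h.trans (genericAut (e⁻¹, false))
  set f' := genericAut (e⁻¹, false) ∘ f with hf'
  have hf1 : ∀ i, f' (cs.simple i) = cs.simple i := fun i ↦ by
    simp [hf', he, genericAut_apply_false, diagramHom_simple]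
  have hf2 := fun i j hij ↦ h1.map_simple_mul_simple hs hf1 hij (hu.1 i j hij)
  let Fix (i j : Fin 3) : Prop := f' (cs.simple i * cs.simple j) = cs.simple i * cs.simple j
  have hflip : ∀ i j, i ≠ j → ¬ Fix i j →
      f' (cs.simple i * cs.simple j) = cs.simple j * cs.simple i :=
    fun i j hij hn ↦ (hf2 i j hij).resolve_left hn
  have hsymm : ∀ i j, i ≠ j → Fix i j → Fix j i := by
    intro i j hij hfix
    by_contra hn
    have e1 := hflip j i hij.symm hn
    -- Fixing `sᵢ sⱼ` while reversing `sⱼ sᵢ` would send both to `sᵢ sⱼ`.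
    have := h1.injOn (hu.1 j i hij.symm) (hu.1 i j hij) (e1.trans hfix.symm)
    exact hij (simple_mul_simple_inj hij.symm this).2
  have hmid : ∀ k, ∃ i j, i ≠ k ∧ k ≠ j ∧ i ≠ j ∧
      ¬ (Fix i k ∧ Fix k j ∧ ¬ Fix i j) ∧ ¬ (¬ Fix i k ∧ ¬ Fix k j ∧ Fix i j) := by
    intro k
    obtain ⟨i, j, hik, hkj, hij, hx⟩ := hu.2 k
    have hr := isReduced_triple hik hkj hij
    have hp : cs.wordProd [i, k, j] = cs.simple i * cs.simple k * cs.simple j := by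
      simp [cs.wordProd_cons, mul_assoc]
    rw [← hp] at hx
    have hl : cs.length (f' (cs.wordProd [i, k, j])) = 3 := (h1.length_eq hx).trans hr.eq
    have hle : ∀ a b, a ≠ b → [a, b].Sublist [i, k, j] →
        f' (cs.simple a * cs.simple b) ≤ f' (cs.wordProd [i, k, j]) := by
      intro a b hab hsub
      rw [h1.le_iff _ (hu.1 a b hab) _ hx]
      exact (simple_mul_simple_le_wordProd_iff hab hr).mpr hsub
    have l1 := hle i k hik (by simp)
    have l2 := hle k j hkj (by simp)
    have l3 := hle i j hij (by simp)
    -- A mixed choice would put three cyclically arranged products below the image of `sᵢ sₖ sⱼ`,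
    -- which has length 3.
    refine ⟨i, j, hik, hkj, hij, ?_, ?_⟩
    · rintro ⟨g1, g2, g3⟩
      rw [g1] at l1
      rw [g2] at l2
      rw [hflip i j hij g3] at l3
      exact not_cyclic_of_length_eq_three hl hik hkj hij l1 l2 l3
    · rintro ⟨g1, g2, g3⟩
      rw [hflip i k hik g1] at l1
      rw [hflip k j hkj g2] at l2
      rw [g3] at l3
      exact not_cyclic_of_length_eq_three hl hij hkj.symm hik l3 l2 l1
  have hsymm' : ∀ i j, i ≠ j → (Fix i j ↔ Fix j i) := fun i j hij ↦
    ⟨hsymm i j hij, hsymm j i hij.symm⟩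
  have hall := forall_or_forall_not_of_middle hsymm' hmid
  rcases hall with hall | hall
  · exact ⟨_, h1.eq_of_agree hf1 hall⟩
  · have h3 := h1.trans (genericAut (1, true))
    refine ⟨_, (genericAut_mul _ _ v).symm.trans (h3.eq_of_agree ?_ ?_)⟩
    · intro i
      simp [hf1, genericAut_apply_true, diagramHom_one]
    · intro i j hij
      simp [hflip i j hij (hall i j hij), genericAut_apply_true, diagramHom_one]

end IsLowerIso

/-! ### Classification of the elements that are not full. -/

theorem Full.diagramHom {u : AffineA2} (hu : Full u) (e : Equiv.Perm (Fin 3)) :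
    Full (diagramHom e u) := by
  refine ⟨fun i j hij ↦ ?_, fun k ↦ ?_⟩
  · have := diagramHom_le e (hu.1 (e⁻¹ i) (e⁻¹ j) (by simpa using hij))
    simpa [diagramHom_simple] using this
  · obtain ⟨i, j, h1, h2, h3, h4⟩ := hu.2 (e⁻¹ k)
    refine ⟨e i, e j, ?_, ?_, by simpa using h3, ?_⟩
    · rintro rfl; simp at h1
    · rintro rfl; simp at h2
    · simpa [diagramHom_simple] using diagramHom_le e h4

/-- Representatives, up to diagram symmetries, of the elements that are not `Full`. -/
def smallWords : List (List (Fin 3)) :=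
  [[], [0], [0, 1], [0, 1, 0], [0, 1, 2], [0, 1, 2, 0], [0, 1, 0, 2], [2, 0, 1, 0],
    [0, 1, 0, 2, 1], [0, 1, 2, 1, 0]]

/-- The combinatorial counterpart of `Full` for words. -/
def FullWord (ω : List (Fin 3)) : Prop :=
  (∀ i j : Fin 3, i ≠ j → [i, j].Sublist ω) ∧
    ∀ k : Fin 3, ∃ i j : Fin 3, i ≠ k ∧ k ≠ j ∧ i ≠ j ∧ [i, k, j].Sublist ω

instance : DecidablePred FullWord := fun _ ↦ inferInstanceAs (Decidable (_ ∧ _))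

theorem FullWord.full {ω : List (Fin 3)} (h : FullWord ω) (hω : cs.IsReduced ω) :
    Full (cs.wordProd ω) := by
  refine ⟨fun i j hij ↦ (simple_mul_simple_le_wordProd_iff hij hω).mpr (h.1 i j hij), fun k ↦ ?_⟩
  obtain ⟨i, j, h1, h2, h3, h4⟩ := h.2 k
  refine ⟨i, j, h1, h2, h3, ?_⟩
  simpa [cs.wordProd_cons, mul_assoc] using wordProd_le_of_sublist hω h4

/-- A word that does not lengthen `ω`, or that is as long as `ω` with a letter appended and is
`FullWord` or, up to a diagram symmetry, one of the `smallWords`. -/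
def IsExtension (ω η : List (Fin 3)) : Prop :=
  η.length ≤ ω.length ∨ η.length = ω.length + 1 ∧
    (FullWord η ∨ ∃ ω' ∈ smallWords, ∃ e : Equiv.Perm (Fin 3), ω'.map e = η)

instance (ω η : List (Fin 3)) : Decidable (IsExtension ω η) :=
  inferInstanceAs (Decidable (_ ∨ _))

theorem wordProd_append_braid (ω η : List (Fin 3)) {i j : Fin 3} (h : i ≠ j) :
    cs.wordProd (ω ++ i :: j :: i :: η) = cs.wordProd (ω ++ j :: i :: j :: η) := by
  have hb := congrArg (fun x ↦ cs.wordProd ω * x * cs.wordProd η) (simple_braid h)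
  simpa [cs.wordProd_append, cs.wordProd_cons, mul_assoc] using hb

theorem wordProd_append_cancel (ω η : List (Fin 3)) (i : Fin 3) :
    cs.wordProd (ω ++ i :: i :: η) = cs.wordProd (ω ++ η) := by
  simp [cs.wordProd_append, cs.wordProd_cons]

theorem exists_isExtension {ω : List (Fin 3)} (hω : ω ∈ smallWords) (i : Fin 3) :
    ∃ η, cs.wordProd (ω ++ [i]) = cs.wordProd η ∧ IsExtension ω η := by
  by_cases h : IsExtension ω (ω ++ [i])
  · exact ⟨_, rfl, h⟩
  by_cases hc : ω.getLast? = some i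
  · obtain ⟨ω', rfl⟩ := List.getLast?_eq_some_iff.mp hc
    refine ⟨ω', ?_, Or.inl (by simp)⟩
    simpa using wordProd_append_cancel ω' [] i
  -- In these seven cases braid moves are needed: three then shorten by a cancellation, the other
  -- four reach a relabelled small word.
  have key : ∀ ω ∈ smallWords, ∀ i : Fin 3, ¬ IsExtension ω (ω ++ [i]) → ω.getLast? ≠ some i →
      (ω, i) ∈ [([0, 1, 0], (1 : Fin 3)), ([0, 1, 2], 1), ([0, 1, 2, 0], 2), ([0, 1, 0, 2], 0),
        ([2, 0, 1, 0], 1), ([2, 0, 1, 0], 2), ([0, 1, 0, 2, 1], 2)] := by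
    decide
  have hcases := key ω hω i h hc
  simp only [List.mem_cons, Prod.mk.injEq, List.not_mem_nil, or_false] at hcases
  clear key h hc hω
  have h01 : (0 : Fin 3) ≠ 1 := by decide
  have h02 : (0 : Fin 3) ≠ 2 := by decide
  have h12 : (1 : Fin 3) ≠ 2 := by decide
  rcases hcases with ⟨rfl, rfl⟩ | ⟨rfl, rfl⟩ | ⟨rfl, rfl⟩ | ⟨rfl, rfl⟩ | ⟨rfl, rfl⟩ | ⟨rfl, rfl⟩ |
    ⟨rfl, rfl⟩
  · refine ⟨[1, 0], ?_, by decide⟩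
    exact (wordProd_append_braid [] [1] h01).trans (wordProd_append_cancel [1, 0] [] 1)
  · exact ⟨[0, 2, 1, 2], wordProd_append_braid [0] [] h12, by decide⟩
  · refine ⟨[1, 0, 1, 2, 0], ?_, by decide⟩
    exact (wordProd_append_braid [0, 1] [] h02.symm).trans (wordProd_append_braid [] [2, 0] h01)
  · exact ⟨[1, 0, 1, 2, 0], wordProd_append_braid [] [2, 0] h01, by decide⟩
  · refine ⟨[2, 1, 0], ?_, by decide⟩
    exact (wordProd_append_braid [2] [1] h01).trans (wordProd_append_cancel [2, 1, 0] [] 1)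
  · exact ⟨[2, 1, 0, 1, 2], wordProd_append_braid [2] [2] h01, by decide⟩
  · refine ⟨[1, 0, 2, 1], ?_, by decide⟩
    exact ((wordProd_append_braid [0, 1, 0] [] h12.symm).trans
      (wordProd_append_braid [] [1, 2, 1] h01)).trans
        (wordProd_append_cancel [1, 0] [2, 1] 1)

/-- Build a reduced word letter by letter: fullness persists upwards, and a small word followed by a
letter that lengthens it becomes full or small again. -/
theorem full_or_exists_smallWord (w : AffineA2) :
    Full w ∨ ∃ ω ∈ smallWords, ∃ e : Equiv.Perm (Fin 3),
      cs.IsReduced ω ∧ w = diagramHom e (cs.wordProd ω) := by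
  obtain ⟨ω, hr, rfl⟩ := cs.exists_isReduced w
  induction ω using List.reverseRecOn with
  | nil =>
    exact Or.inr ⟨[], by decide, 1, by simp [CoxeterSystem.IsReduced], by simp⟩
  | append_singleton ω i ih =>
    have hd := not_isRightDescent_wordProd hr
    rcases ih (IsReduced.of_append hr) with h | ⟨ω', hω', e, hr', h⟩
    · left
      rw [cs.wordProd_append, cs.wordProd_singleton]
      exact h.mono (lt_mul_simple hd).le
    · have hw : cs.wordProd (ω ++ [i]) = diagramHom e (cs.wordProd (ω' ++ [e⁻¹ i])) := by
        simp [cs.wordProd_append, h, diagramHom_simple]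
      have hlen : ω.length = ω'.length := by
        rw [← (IsReduced.of_append hr).eq, h, length_diagramHom, hr'.eq]
      obtain ⟨η, hη, hext⟩ := exists_isExtension hω' (e⁻¹ i)
      rw [hη] at hw
      have hl : cs.length (cs.wordProd η) = ω'.length + 1 := by
        rw [← length_diagramHom e, ← hw, hr.eq, ← hlen]; simp
      rcases hext with hle | ⟨hηl, hfull | ⟨ω'', hω'', e', rfl⟩⟩
      · have := cs.length_wordProd_le η
        omega
      · left
        rw [hw]
        exact (hfull.full (hl.trans hηl.symm)).diagramHom e
      · right
        refine ⟨ω'', hω'', e * e', ?_, ?_⟩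
        · rw [CoxeterSystem.IsReduced, ← length_diagramHom e', diagramHom_wordProd, hl, ← hηl,
            List.length_map]
        · rw [hw, ← diagramHom_wordProd, diagramHom_diagramHom]

/-! ### Separating the small words, and conclusion. -/

theorem IsLowerIso.of_orderAut (g : AffineA2 ≃o AffineA2) (u : AffineA2) :
    IsLowerIso u (g u) g where
  le_iff x _ y _ := g.le_iff_le
  map_le x hx := g.monotone hx
  exists_eq y hy := ⟨g.symm y, by rwa [OrderIso.symm_apply_le], by simp⟩

/-- The elements of length `2` below `u`. -/
def lengthTwoBelow (u : AffineA2) : Set AffineA2 := {x | x ≤ u ∧ cs.length x = 2}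

theorem IsLowerIso.ncard_lengthTwoBelow {u v : AffineA2} {f : AffineA2 → AffineA2}
    (h : IsLowerIso u v f) : (lengthTwoBelow v).ncard = (lengthTwoBelow u).ncard := by
  have : lengthTwoBelow v = f '' lengthTwoBelow u := by
    ext y
    constructor
    · rintro ⟨hy, hl⟩
      obtain ⟨x, hx, rfl⟩ := h.exists_eq y hy
      exact ⟨x, ⟨hx, by rwa [h.length_eq hx] at hl⟩, rfl⟩
    · rintro ⟨x, ⟨hx, hl⟩, rfl⟩
      exact ⟨h.map_le x hx, by rwa [h.length_eq hx]⟩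
  rw [this]
  exact Set.InjOn.ncard_image fun x hx y hy e ↦ h.injOn hx.1 hy.1 e

/-- The pairs of distinct letters that are subwords of `ω`. -/
def pairSubwords (ω : List (Fin 3)) : Finset (Fin 3 × Fin 3) :=
  {p | p.1 ≠ p.2 ∧ [p.1, p.2].Sublist ω}

theorem ncard_lengthTwoBelow_wordProd {ω : List (Fin 3)} (hω : cs.IsReduced ω) :
    (lengthTwoBelow (cs.wordProd ω)).ncard = (pairSubwords ω).card := by
  have : lengthTwoBelow (cs.wordProd ω) =
      (fun p : Fin 3 × Fin 3 ↦ cs.simple p.1 * cs.simple p.2) '' (pairSubwords ω) := by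
    ext x
    constructor
    · rintro ⟨hx, hl⟩
      obtain ⟨i, j, hij, rfl⟩ := exists_eq_simple_mul_simple hl
      refine ⟨(i, j), ?_, rfl⟩
      simpa [pairSubwords, hij] using (simple_mul_simple_le_wordProd_iff hij hω).mp hx
    · rintro ⟨⟨i, j⟩, hp, rfl⟩
      obtain ⟨hij, hs⟩ : i ≠ j ∧ [i, j].Sublist ω := by simpa [pairSubwords] using hp
      exact ⟨(simple_mul_simple_le_wordProd_iff hij hω).mpr hs, length_simple_mul_simple hij⟩
  rw [this, Set.InjOn.ncard_image, Set.ncard_coe_finset]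
  rintro ⟨i, j⟩ hp ⟨k, l⟩ - e
  have hij : i ≠ j := by
    have : i ≠ j ∧ [i, j].Sublist ω := by simpa [pairSubwords] using hp
    exact this.1
  obtain ⟨rfl, rfl⟩ := simple_mul_simple_inj hij e
  rfl

/-- The only coincidence is between `[0, 1, 0, 2]` and `[2, 0, 1, 0]`; reversing a word inverts the
element, which stays in the orbit. -/
theorem smallWords_eq_or_eq_reverse : ∀ ω ∈ smallWords, ∀ ω' ∈ smallWords,
    ω.length = ω'.length → (pairSubwords ω).card = (pairSubwords ω').card →
      ω' = ω ∨ ω' = ω.reverse := by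
  decide

theorem IsLowerIso.exists_genericAut {u v : AffineA2} {f : AffineA2 → AffineA2}
    (h : IsLowerIso u v f) (hu : ¬ Full u) (hv : ¬ Full v) : ∃ p, v = genericAut p u := by
  have hl : cs.length v = cs.length u := by rw [← h.map_top, h.length_eq le_rfl]
  have hn := h.ncard_lengthTwoBelow
  obtain ⟨ω, hω, e, hr, rfl⟩ := (full_or_exists_smallWord u).resolve_left hu
  obtain ⟨ω', hω', e', hr', rfl⟩ := (full_or_exists_smallWord v).resolve_left hv
  have key : ∀ (e : Equiv.Perm (Fin 3)) (x : AffineA2),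
      (lengthTwoBelow (diagramHom e x)).ncard = (lengthTwoBelow x).ncard :=
    fun e x ↦ (IsLowerIso.of_orderAut (diagramOrderIso e) x).ncard_lengthTwoBelow
  rw [key, key, ncard_lengthTwoBelow_wordProd hr, ncard_lengthTwoBelow_wordProd hr'] at hn
  rw [length_diagramHom, length_diagramHom, hr.eq, hr'.eq] at hl
  rcases smallWords_eq_or_eq_reverse ω hω ω' hω' hl.symm hn.symm with rfl | rfl
  · exact ⟨(e' * e⁻¹, false), by simp [genericAut_apply_false, diagramHom_diagramHom]⟩
  · exact ⟨(e' * e⁻¹, true), by simp [genericAut_apply_true, diagramHom_diagramHom]⟩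

theorem mem_orbit_of_orderIso {u v : AffineA2}
    (φ : Set.Icc (1 : AffineA2) u ≃o Set.Icc (1 : AffineA2) v) : v ∈ MulAction.orbit G u := by
  obtain ⟨f, hf⟩ := IsLowerIso.of_orderIso φ
  by_cases hu : Full u
  · rw [MulAction.mem_orbit_symm, mem_orbit_iff]
    obtain ⟨p, hp⟩ := hf.exists_genericAut_of_full hu
    exact ⟨p, hp.symm⟩
  -- Only one of the two elements need be full, since `φ` can be inverted.
  by_cases hv : Full v
  · obtain ⟨f', hf'⟩ := IsLowerIso.of_orderIso φ.symm
    obtain ⟨p, hp⟩ := hf'.exists_genericAut_of_full hv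
    exact mem_orbit_iff.mpr ⟨p, hp.symm⟩
  · exact mem_orbit_iff.mpr (hf.exists_genericAut hu hv)

end AffineA2

theorem mainTheorem9 :
    Nat.card AffineA2.G = 12 ∧
      ∀ u v : AffineA2,
        Nonempty (Set.Icc (1 : AffineA2) u ≃o Set.Icc (1 : AffineA2) v) ↔
          v ∈ MulAction.orbit AffineA2.G u :=
  ⟨AffineA2.card_G, fun _ _ ↦
    ⟨fun ⟨φ⟩ ↦ AffineA2.mem_orbit_of_orderIso φ, AffineA2.nonempty_orderIso_of_mem_orbit⟩⟩
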